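/- Let $(V,\otimes,k)$ be a commutative quantale, i.e. a complete lattice with a commutative monoid structure whose multiplication preserves suprema in each variable, with $k\neq\bot$; write $[-,-]$ for its internal hom. Let $L$ be the list monad on sets, with multiplication $m$ given by concatenation, and for a map $r:X\times Y\to V$ let $Lr(\underline x,\underline y)=r(x_1,y_1)\otimes\dots\otimes r(x_n,y_n)$ if $\underline x,\underline y$ are lists of the same length $n$ (so $k$ if both are empty), and $\bot$ otherwise. An $(L,V)$-category is a set $X$ with a map $a:LX\times X\to V$ such that $k\le a((x),x)$ and $La(\underline{\underline x},\underline y)\otimes a(\underline y,z)\le a(m(\underline{\underline x}),z)$ for all $x,z\in X$, $\underline y\in LX$, $\underline{\underline x}\in LLX$. It is separated if $k\le a((x),y)$ and $k\le a((y),x)$ imply $x=y$. An $(L,V)$-functor $f:(X,a)\to(Y,b)$ is a map with $a(\underline x,x)\le b(Lf(\underline x),f(x))$ for all $\underline x\in LX$, $x\in X$; it is fully faithful if equality always holds. $(X,a)$ is injective with respect to fully faithful functors if for every fully faithful $(L,V)$-functor $i:Y\to Z$ and every $(L,V)$-functor $g:Y\to X$ there is an $(L,V)$-functor $h:Z\to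 X$ with $h\circ i=g$. A $V$-category is a set $Q$ with $a_0:Q\times Q\to V$ such that $k\le a_0(x,x)$ and $a_0(x,y)\otimes a_0(y,z)\le a_0(x,z)$; it is separated if $k\le a_0(x,y)$ and $k\le a_0(y,x)$ imply $x=y$. A $V$-functor $f:(X,a)\to(Y,b)$ is a map with $a(x,x')\le b(f(x),f(x'))$, and a distributor $j:(X,a)\to(Z,c)$ is a map $j:X\times Z\to V$ with $a(x,x')\otimes j(x',z)\le j(x,z)$ and $j(x,z)\otimes c(z,z')\le j(x,z')$. The colimit of a $V$-functor $f:(X,a)\to(Y,b)$ weighted by $j$ is a $V$-functor $g:(Z,c)\to(Y,b)$ with $b(g(z),y)=\bigwedge_{x\in X}[j(x,z),b(f(x),y)]$ for all $z,y$. A $V$-category is cocomplete if all weighted colimits in it exist, and a $V$-functor is cocontinuous if it preserves all weighted colimits that exist. A $V$-quantale $(Q,a_0,\ast,u)$ is a separated cocomplete $V$-category $(Q,a_0)$ with a monoid structure $(\ast,u)$ on $Q$ such that $a_0(x,x')\otimes a_0(y,y')\le a_0(x\ast y,x'\ast y')$ and, for every $x\in Q$, the maps $x\ast(-)$ and $(-)\ast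 x$ are cocontinuous. It is regarded as an $(L,V)$-category with structure $a((x_1,\dots,x_n),y)=a_0(x_1\ast\dots\ast x_n,y)$, where the empty product is $u$. Theorem. A separated $(L,V)$-category $(X,a)$ is injective with respect to fully faithful functors if and only if it is a $V$-quantale, i.e. if and only if there is a $V$-quantale $(X,a_0,\ast,u)$ on the set $X$ with $a((x_1,\dots,x_n),y)=a_0(x_1\ast\dots\ast x_n,y)$ for all $(x_1,\dots,x_n)\in LX$ and $y\in X$. -/

import Mathlib

universe u

/-! Throughout, a commutative quantale `(V, ⊗, k)` is a complete lattice `V` with a commutative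
monoid structure `(V, *, 1)` whose multiplication preserves suprema in each variable (`IsQuantale`).
Its internal hom is `[v, w] = v ⇨ᵣ w`, the largest `t` with `v * t ≤ w`. -/

open scoped Quantale

namespace QuantaleEnriched

section VCat

/-- A `V`-category structure on the set `X`: a `V`-relation `a : X × X → V` with `Id ≤ a` and
`a · a ≤ a`, written pointwise. -/
structure VCategory (V : Type u) [CommMonoid V] [CompleteLattice V] [IsQuantale V]
    (X : Type u) where
  hom : X → X → V
  id_le : ∀ x, 1 ≤ hom x x
  comp_le : ∀ x y z, hom x y * hom y z ≤ hom x z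

variable {V : Type u} [CommMonoid V] [CompleteLattice V] [IsQuantale V]
variable {X Y Z : Type u}

/-- `V`-functors `(X, a) → (Y, b)`. -/
def IsVFunctor (a : VCategory V X) (b : VCategory V Y) (f : X → Y) : Prop :=
  ∀ x x', a.hom x x' ≤ b.hom (f x) (f x')

/-- `V`-distributors `j : (X, a) ⇸ (Z, c)`: `V`-relations with `j · a ≤ j` and `c · j ≤ j`,
written pointwise. -/
def IsVDistributor (a : VCategory V X) (c : VCategory V Z) (j : X → Z → V) : Prop :=
  (∀ x x' z, a.hom x x' * j x' z ≤ j x z) ∧ (∀ x z z', j x z * c.hom z z' ≤ j x z')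

/-- The function `g : Z → Y` is the colimit of `f : X → Y` weighted by `j : X ⇸ Z`, that is,
`b(g(z), y) = ⋀ₓ [j(x, z), b(f(x), y)]`, and it is a `V`-functor. -/
def IsVColimit (c : VCategory V Z) (b : VCategory V Y)
    (j : X → Z → V) (f : X → Y) (g : Z → Y) : Prop :=
  IsVFunctor c b g ∧ ∀ z y, b.hom (g z) y = ⨅ x, (j x z ⇨ᵣ b.hom (f x) y)

/-- `(Y, b)` is cocomplete: all weighted colimits exist. -/
def VCategory.IsCocomplete (b : VCategory V Y) : Prop :=
  ∀ (X Z : Type u) (a : VCategory V X) (c : VCategory V Z) (f : X → Y) (j : X → Z → V),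
    IsVFunctor a b f → IsVDistributor a c j → ∃ g : Z → Y, IsVColimit c b j f g

/-- `h : (Y, b) → (W, d)` is a cocontinuous `V`-functor: it preserves all weighted colimits
which exist in `(Y, b)`. -/
def IsCocontinuous {W : Type u} (b : VCategory V Y) (d : VCategory V W) (h : Y → W) : Prop :=
  IsVFunctor b d h ∧
    ∀ (X Z : Type u) (a : VCategory V X) (c : VCategory V Z) (f : X → Y) (j : X → Z → V)
      (g : Z → Y), IsVFunctor a b f → IsVDistributor a c j → IsVColimit c b j f g →
        IsVColimit c d j (h ∘ f) (h ∘ g)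

/-- `(X, a)` is separated: its underlying order (`x ≤ y` iff `k ≤ a(x, y)`) is antisymmetric. -/
def VCategory.IsSeparated (a : VCategory V X) : Prop :=
  ∀ x y, 1 ≤ a.hom x y → 1 ≤ a.hom y x → x = y

end VCat

/-- A monoidal `V`-category structure on the set `X`: a `V`-category with a monoid structure on
`X` whose multiplication is a `V`-functor `X ⊠ X → X`. (That the unit is a `V`-functor from the
one-point `V`-category `(1, k)` is automatic.) -/
structure MonoidalVCategory (V : Type u) [CommMonoid V] [CompleteLattice V] [IsQuantale V]
    (X : Type u) extends VCategory V X where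
  tensor : X → X → X
  unit : X
  tensor_assoc : ∀ x y z, tensor (tensor x y) z = tensor x (tensor y z)
  unit_tensor : ∀ x, tensor unit x = x
  tensor_unit : ∀ x, tensor x unit = x
  tensor_le : ∀ x x' y y', hom x x' * hom y y' ≤ hom (tensor x y) (tensor x' y')

section

variable {V : Type u} [CommMonoid V] [CompleteLattice V] [IsQuantale V]
variable {X Y : Type u}

/-- The map `α(x₁, …, xₙ) = x₁ ∗ ⋯ ∗ xₙ`, with the unit as the value at the empty list. -/
def MonoidalVCategory.tensorList (M : MonoidalVCategory V X) (xs : List X) : X :=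
  xs.foldr M.tensor M.unit

/-- A `V`-quantale: a monoid in separated cocomplete `V`-categories whose multiplication is
cocontinuous in each variable. -/
structure MonoidalVCategory.IsVQuantale (M : MonoidalVCategory V X) : Prop where
  separated : M.toVCategory.IsSeparated
  cocomplete : M.toVCategory.IsCocomplete
  cocontinuous_left : ∀ x, IsCocontinuous M.toVCategory M.toVCategory (fun y => M.tensor x y)
  cocontinuous_right : ∀ x, IsCocontinuous M.toVCategory M.toVCategory (fun y => M.tensor y x)

/-- The extension of the list monad to `V`-relations: `r(x₁, y₁) ⊗ ⋯ ⊗ r(xₙ, yₙ)` for lists of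
the same length (so `k` for two empty lists), and `⊥` otherwise. -/
def listRel (r : X → Y → V) : List X → List Y → V
  | [], [] => 1
  | x :: xs, y :: ys => r x y * listRel r xs ys
  | [], _ :: _ => ⊥
  | _ :: _, [] => ⊥

end

/-- An `(L, V)`-category structure on the set `X`: a `V`-relation `a : L(X) × X → V` with
`e° ≤ a` and `a · La · m° ≤ a`, written pointwise; `e` and `m` are the unit `x ↦ (x)` and the
multiplication (flattening) of the list monad `L`. -/
structure LVCategory (V : Type u) [CommMonoid V] [CompleteLattice V] [IsQuantale V]
    (X : Type u) where
  hom : List X → X → V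
  id_le : ∀ x, 1 ≤ hom [x] x
  comp_le : ∀ (xss : List (List X)) (ys : List X) (z : X),
    listRel hom xss ys * hom ys z ≤ hom xss.flatten z

section LVCat

variable {V : Type u} [CommMonoid V] [CompleteLattice V] [IsQuantale V]
variable {X Y : Type u}

/-- `(L, V)`-functors `(X, a) → (Y, b)`. -/
def IsLVFunctor (a : LVCategory V X) (b : LVCategory V Y) (f : X → Y) : Prop :=
  ∀ xs x, a.hom xs x ≤ b.hom (xs.map f) (f x)

/-- Fully faithful `(L, V)`-functors `(X, a) → (Y, b)`. -/
def IsFullyFaithful (a : LVCategory V X) (b : LVCategory V Y) (f : X → Y) : Prop :=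
  ∀ xs x, a.hom xs x = b.hom (xs.map f) (f x)

/-- `(X, a)` is separated: its underlying order (`x ≤ y` iff `k ≤ a((x), y)`) is
antisymmetric. -/
def LVCategory.IsSeparated (a : LVCategory V X) : Prop :=
  ∀ x y, 1 ≤ a.hom [x] y → 1 ≤ a.hom [y] x → x = y

/-- `(X, a)` is injective with respect to fully faithful `(L, V)`-functors. -/
def LVCategory.IsInjective (a : LVCategory V X) : Prop :=
  ∀ (Y Z : Type u) (b : LVCategory V Y) (c : LVCategory V Z) (i : Y → Z) (g : Y → X),
    IsFullyFaithful b c i → IsLVFunctor b a g → ∃ h : Z → X, IsLVFunctor c a h ∧ h ∘ i = g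

/-- `(X, a)` is a `V`-quantale: it is represented by a `V`-quantale `(X, a₀, ∗, u)` on the same
set, `a((x₁, …, xₙ), y) = a₀(x₁ ∗ ⋯ ∗ xₙ, y)`. -/
def LVCategory.IsVQuantale (a : LVCategory V X) : Prop :=
  ∃ M : MonoidalVCategory V X, M.IsVQuantale ∧ ∀ xs y, a.hom xs y = M.hom (M.tensorList xs) y

end LVCat

end QuantaleEnriched

/-!
An `(L, V)`-category is a thin `V`-enriched multicategory, and the theorem says that the injective
separated ones are exactly those represented by a quantale.

Suppose `(X, a)` is injective. All functions `ψ : List X → V` form an `(L, V)`-category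
(`functionCategory`): it is the free `V`-quantale on the monoid `List X` with its convolution
product, and `x ↦ a(-, x)` embeds `(X, a)` into it fully faithfully
(`isFullyFaithful_representable`). Injectivity yields a retraction `h` of this embedding.
Applying `h` to the convolution of `a(-, x₁), …, a(-, xₙ)` produces an element `α(x₁, …, xₙ)` which
represents the list, even inside longer lists: `a(xss.flatten, y) = a(xss.map α, y)`
(`hom_map_convolution`). By separatedness `α` is an algebra structure for the list monad, that is, a
monoid. Applying `h` to `⋁ₓ j(x, z) ⊗ a(-, f x)` produces weighted colimits, and these are
preserved in each variable of a list (`hom_weightedJoin`), which is cocompleteness and cocontinuity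
at the same time. Separatedness makes all colimits agree with those obtained from `h`.

Conversely, let `(X, a)` be represented by a `V`-quantale, let `i : (Y, b) → (Z, c)` be fully
faithful and `g : (Y, b) → (X, a)` an `(L, V)`-functor. The left Kan extension of `g` along `i`,
whose value at `z` is the colimit of `ys ↦ g(y₁) ∗ ⋯ ∗ g(yₙ)` weighted by `ys ↦ c(i(ys), z)`,
extends `g` because `i` is fully faithful and `X` is separated. It is an `(L, V)`-functor because
products of such colimits can be expanded one factor at a time (`le_hom_tensor_tensorList`).
-/

namespace QuantaleEnriched

open Quantale

variable {V : Type u} [CommMonoid V] [CompleteLattice V]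

/-! ### Extending relations to lists -/

section ListRel

variable {A B C : Type u}

@[simp]
theorem listRel_nil_nil (r : A → B → V) : listRel r [] [] = 1 := rfl

@[simp]
theorem listRel_cons_cons (r : A → B → V) (x : A) (xs : List A) (y : B) (ys : List B) :
    listRel r (x :: xs) (y :: ys) = r x y * listRel r xs ys := rfl

@[simp]
theorem listRel_nil_cons (r : A → B → V) (y : B) (ys : List B) :
    listRel r [] (y :: ys) = ⊥ := rfl

@[simp]
theorem listRel_cons_nil (r : A → B → V) (x : A) (xs : List A) :
    listRel r (x :: xs) [] = ⊥ := rfl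

theorem listRel_map_right (r : A → C → V) (f : B → C) (xs : List A) (ys : List B) :
    listRel r xs (ys.map f) = listRel (fun x y => r x (f y)) xs ys := by
  induction xs generalizing ys with
  | nil => cases ys <;> rfl
  | cons x xs ih => cases ys <;> simp [ih]

theorem listRel_map_left (r : C → B → V) (f : A → C) (xs : List A) (ys : List B) :
    listRel r (xs.map f) ys = listRel (fun x y => r (f x) y) xs ys := by
  induction xs generalizing ys with
  | nil => cases ys <;> rfl
  | cons x xs ih => cases ys <;> simp [ih]

variable [IsQuantale V]

theorem one_le_listRel_self {r : A → A → V} (h : ∀ x, 1 ≤ r x x) (xs : List A) :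
    1 ≤ listRel r xs xs := by
  induction xs with
  | nil => simp
  | cons x xs ih => simpa using mul_le_mul' (h x) ih

theorem listRel_append_le (r : A → B → V) (xs xs' : List A) (ys ys' : List B) :
    listRel r xs ys * listRel r xs' ys' ≤ listRel r (xs ++ xs') (ys ++ ys') := by
  induction xs generalizing ys with
  | nil => cases ys <;> simp
  | cons x xs ih => cases ys <;> simp [mul_assoc, mul_le_mul_right (ih _)]

theorem listRel_append_right (r : A → B → V) (xs : List A) (ys ys' : List B) :
    listRel r xs (ys ++ ys') =
      listRel r (xs.take ys.length) ys * listRel r (xs.drop ys.length) ys' := by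
  induction ys generalizing xs with
  | nil => simp
  | cons y ys ih => cases xs <;> simp [ih, mul_assoc]

end ListRel

variable [IsQuantale V]

/-! ### Residuation and `(L, V)`-categories -/

theorem le_iInf_residuation_iff {ι : Sort*} {t : V} {v w : ι → V} :
    t ≤ ⨅ i, (v i ⇨ᵣ w i) ↔ ∀ i, v i * t ≤ w i := by
  simp [rightMulResiduation_le_iff_mul_le]

theorem iSup_mul_le_iff {ι : Sort*} {f : ι → V} {x v : V} :
    (⨆ i, f i) * x ≤ v ↔ ∀ i, f i * x ≤ v := by
  simp only [mul_comm _ x, ← rightMulResiduation_le_iff_mul_le, iSup_le_iff]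

namespace LVCategory

variable {X : Type u} (a : LVCategory V X)

theorem one_le_listRel_hom (xs : List X) : 1 ≤ listRel a.hom (xs.map fun x => [x]) xs := by
  rw [listRel_map_left]
  exact one_le_listRel_self a.id_le xs

/-- Composition in one place of a list. -/
theorem hom_mul_hom_le (ps xs qs : List X) (x z : X) :
    a.hom xs x * a.hom (ps ++ x :: qs) z ≤ a.hom (ps ++ xs ++ qs) z := by
  have h := a.comp_le (ps.map (fun x => [x]) ++ xs :: qs.map fun x => [x]) (ps ++ x :: qs) z
  have e : (ps.map (fun x => [x]) ++ xs :: qs.map fun x => [x]).flatten = ps ++ xs ++ qs := by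
    simp [← List.flatMap_def]
  rw [e] at h
  refine le_trans (mul_le_mul_left ?_ _) h
  refine le_trans ?_ (listRel_append_le _ _ _ _ _)
  simpa using mul_le_mul' (a.one_le_listRel_hom ps)
    (mul_le_mul_right (a.one_le_listRel_hom qs) (a.hom xs x))

theorem IsSeparated.eq_of_hom_eq {a : LVCategory V X} (ha : a.IsSeparated) {x x' : X}
    (h : ∀ y, a.hom [x] y = a.hom [x'] y) : x = x' :=
  ha x x' (h x' ▸ a.id_le x') (h x ▸ a.id_le x)

end LVCategory

/-! ### The `(L, V)`-category of functions on lists -/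

section FunctionCategory

variable {X : Type u}

/-- If composing `r` with `s`, followed by flattening, stays below `q`, then composing the
extensions of `r` and `s` to lists stays below the supremum of `listRel q wss bs` over all lists of
lists `wss` with the same flattening as `xss`. That supremum appears here through its upper bounds
`v`. -/
theorem listRel_flatten_mul_le {A B : Type u} {r : List X → A → V} {s : List A → B → V}
    {q : List X → B → V}
    (h : ∀ xss as b, listRel r xss as * s as b ≤ q xss.flatten b) {t v : V}
    (xss : List (List X)) (ass : List (List A)) (bs : List B)
    (hv : ∀ wss : List (List X), wss.flatten = xss.flatten → listRel q wss bs * t ≤ v) :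
    listRel r xss ass.flatten * listRel s ass bs * t ≤ v := by
  induction ass generalizing xss bs t with
  | nil =>
    cases bs with
    | cons b bs => simp
    | nil => cases xss with
      | nil => simpa using hv [] rfl
      | cons xs xss => simp
  | cons as ass ih =>
    cases bs with
    | nil => simp
    | cons b bs =>
      rw [List.flatten_cons, listRel_append_right, listRel_cons_cons, mul_mul_mul_comm, mul_assoc]
      refine (mul_le_mul_left (h _ _ _) _).trans ?_
      rw [mul_left_comm]
      refine ih _ _ fun wss hw => ?_
      rw [mul_left_comm, ← mul_assoc]
      -- Only the first `as.length` members of `xss` are regrouped into one list.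
      refine hv ((xss.take as.length).flatten :: wss) ?_
      rw [List.flatten_cons, hw, ← List.flatten_append, List.take_append_drop]

/-- The value of the function `ψ` at `xs`, as a `V`-relation from `List X` to `List X → V`. -/
def evalRel (xs : List X) (ψ : List X → V) : V := ψ xs

variable (V X) in
/-- The `(L, V)`-category of all functions `List X → V`: `t ≤ hom (ψ₁, …, ψₙ) φ` means that
`ψ₁(xs₁) ⊗ ⋯ ⊗ ψₙ(xsₙ) ⊗ t ≤ φ(xs₁ ++ ⋯ ++ xsₙ)` for all lists `xs₁, …, xsₙ`. Families whose
number of lists is not `n` contribute `⊥ ⇨ᵣ _ = ⊤` to the infimum. No compatibility of the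
functions with an `(L, V)`-category structure on `X` is required. -/
def functionCategory : LVCategory V (List X → V) where
  hom ψs φ := ⨅ xss : List (List X), (listRel evalRel xss ψs ⇨ᵣ φ xss.flatten)
  id_le ψ := by
    rw [le_iInf_residuation_iff]
    rintro (_ | ⟨xs, _ | ⟨ys, xss⟩⟩) <;> simp [evalRel]
  comp_le ψss φs χ := by
    rw [le_iInf_residuation_iff]
    intro xss
    rw [← mul_assoc]
    refine listRel_flatten_mul_le (q := evalRel) (fun wss ψs φ => ?_) _ _ _ fun wss hw => ?_
    · exact le_iInf_residuation_iff.1 (le_refl (⨅ xss : List (List X),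
        (listRel evalRel xss ψs ⇨ᵣ φ xss.flatten))) wss
    · rw [← hw]
      exact le_iInf_residuation_iff.1 (le_refl (⨅ xss : List (List X),
        (listRel evalRel xss φs ⇨ᵣ χ xss.flatten))) wss

theorem le_functionCategory_hom_iff {t : V} {ψs : List (List X → V)} {φ : List X → V} :
    t ≤ (functionCategory V X).hom ψs φ ↔
      ∀ xss, listRel evalRel xss ψs * t ≤ φ xss.flatten :=
  le_iInf_residuation_iff

/-- The Yoneda embedding `x ↦ a(-, x)`. -/
def LVCategory.representable (a : LVCategory V X) (x : X) : List X → V := fun xs => a.hom xs x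

theorem LVCategory.listRel_map_representable (a : LVCategory V X) (xss : List (List X))
    (ys : List X) :
    listRel evalRel xss (ys.map a.representable) = listRel a.hom xss ys :=
  listRel_map_right _ _ _ _

theorem LVCategory.isFullyFaithful_representable (a : LVCategory V X) :
    IsFullyFaithful a (functionCategory V X) a.representable := by
  intro xs y
  refine le_antisymm (le_functionCategory_hom_iff.2 fun xss => ?_) ?_
  · rw [a.listRel_map_representable]
    exact a.comp_le _ _ _
  · have h := le_functionCategory_hom_iff.1
      (le_refl ((functionCategory V X).hom (xs.map a.representable) (a.representable y)))
      (xs.map fun x => [x])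
    rw [a.listRel_map_representable, ← List.flatMap_def, List.flatMap_singleton'] at h
    exact le_trans (le_mul_of_one_le_left' (a.one_le_listRel_hom xs)) h

end FunctionCategory

/-! ### Injective `(L, V)`-categories are `V`-quantales -/

section Retraction

variable {X : Type u}

/-- A retraction `h` of the Yoneda embedding in the category of `(L, V)`-categories. -/
structure IsYonedaRetraction (a : LVCategory V X) (h : (List X → V) → X) : Prop where
  isLVFunctor : IsLVFunctor (functionCategory V X) a h
  apply_representable : ∀ x, h (a.representable x) = x

theorem LVCategory.IsInjective.exists_isYonedaRetraction {a : LVCategory V X}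
    (ha : a.IsInjective) : ∃ h, IsYonedaRetraction a h := by
  obtain ⟨h, hf, hi⟩ := ha X (List X → V) a (functionCategory V X) a.representable id
    a.isFullyFaithful_representable (fun xs x => by simp)
  exact ⟨h, hf, congrFun hi⟩

/-- The convolution product of the functions `a(-, x₁), …, a(-, xₙ)`. -/
def LVCategory.convolution (a : LVCategory V X) (xs ws : List X) : V :=
  ⨆ (xss : List (List X)) (_ : xss.flatten = ws), listRel a.hom xss xs

/-- The join `⋁ₓ j(x) ⊗ a(-, f x)`. -/
def LVCategory.weightedJoin {A : Type u} (a : LVCategory V X) (j : A → V) (f : A → X)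
    (ws : List X) : V :=
  ⨆ x, j x * a.hom ws (f x)

/-- The convolution product is associative: a product of convolutions expands into convolutions of
the concatenated list. -/
theorem LVCategory.listRel_map_convolution_mul_le (a : LVCategory V X) {t v : V}
    (wss xss : List (List X))
    (hv : ∀ uss : List (List X), uss.flatten = wss.flatten →
      listRel a.hom uss xss.flatten * t ≤ v) :
    listRel evalRel wss (xss.map a.convolution) * t ≤ v := by
  induction xss generalizing wss t with
  | nil => cases wss with
    | nil => exact hv [] rfl
    | cons ws wss => simp
  | cons xs xss ih => cases wss with
    | nil => simp
    | cons ws wss =>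
      simp only [List.map_cons, listRel_cons_cons, evalRel, LVCategory.convolution,
        mul_assoc, iSup_mul_le_iff]
      rintro uss rfl
      rw [mul_left_comm]
      refine ih wss fun uss' hu => ?_
      rw [← mul_assoc, mul_comm (listRel a.hom uss' _)]
      refine (mul_le_mul_left (listRel_append_le _ _ _ _ _) _).trans (hv (uss ++ uss') ?_)
      simp [hu]

/-- Convolution preserves weighted joins in each variable. -/
theorem LVCategory.listRel_weightedJoin_mul_le {A : Type u} (a : LVCategory V X) (j : A → V)
    (f : A → X) {t v : V} (ps qs : List X) (wss : List (List X))
    (hv : ∀ x, listRel a.hom wss (ps ++ f x :: qs) * (j x * t) ≤ v) :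
    listRel evalRel wss
      (ps.map a.representable ++ a.weightedJoin j f :: qs.map a.representable) * t ≤ v := by
  induction ps generalizing wss t with
  | nil => cases wss with
    | nil => simp
    | cons ws wss =>
      simp only [List.map_nil, List.nil_append, listRel_cons_cons, evalRel,
        LVCategory.weightedJoin, mul_assoc, iSup_mul_le_iff]
      intro x
      refine le_of_eq_of_le ?_ (hv x)
      rw [List.nil_append, listRel_cons_cons, ← a.listRel_map_representable]
      ac_rfl
  | cons p ps ih => cases wss with
    | nil => simp
    | cons ws wss =>
      rw [List.map_cons, List.cons_append, listRel_cons_cons, mul_right_comm, mul_comm]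
      refine ih wss fun x => le_of_eq_of_le ?_ (hv x)
      rw [List.cons_append, listRel_cons_cons]
      change _ * (_ * (a.hom ws p * t)) = _
      ac_rfl

namespace IsYonedaRetraction

variable {a : LVCategory V X} {h : (List X → V) → X} (H : IsYonedaRetraction a h)
include H

theorem map_comp_representable (xs : List X) : (xs.map a.representable).map h = xs := by
  rw [List.map_map]
  exact List.map_id'' H.apply_representable xs

/-- Lower bounds for maps out of elements `h(ψ)`, from functoriality of `h` at a representable
target. -/
theorem le_hom_map {t : V} {ψs : List (List X → V)} {y : X}
    (ht : ∀ xss, listRel evalRel xss ψs * t ≤ a.hom xss.flatten y) : t ≤ a.hom (ψs.map h) y := by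
  have := (le_functionCategory_hom_iff (φ := a.representable y).2 ht).trans (H.isLVFunctor _ _)
  rwa [H.apply_representable] at this

/-- Lower bounds for maps into an element `h(ψ)`, from functoriality of `h` at representable
sources. -/
theorem le_hom_apply {t : V} {xs : List X} {ψ : List X → V}
    (ht : ∀ xss, listRel a.hom xss xs * t ≤ ψ xss.flatten) : t ≤ a.hom xs (h ψ) := by
  have := (le_functionCategory_hom_iff (ψs := xs.map a.representable).2 fun xss => by
    rw [a.listRel_map_representable]; exact ht xss).trans (H.isLVFunctor _ _)
  rwa [H.map_comp_representable] at this

theorem one_le_hom_convolution (xs : List X) : 1 ≤ a.hom xs (h (a.convolution xs)) :=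
  H.le_hom_apply fun xss => by
    rw [mul_one]
    exact le_iSup₂_of_le xss rfl le_rfl

/-- The elements `α(xs) = h(convolution xs)` represent lists, even inside longer lists. -/
theorem hom_map_convolution (xss : List (List X)) (y : X) :
    a.hom (xss.map fun xs => h (a.convolution xs)) y = a.hom xss.flatten y := by
  refine le_antisymm ?_ ?_
  · refine le_trans (le_mul_of_one_le_left' ?_) (a.comp_le xss _ y)
    rw [listRel_map_right]
    exact one_le_listRel_self H.one_le_hom_convolution xss
  · have := H.le_hom_map (y := y) (ψs := xss.map a.convolution) (t := a.hom xss.flatten y)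
      fun wss => a.listRel_map_convolution_mul_le wss xss fun uss hu => by
        rw [← hu]; exact a.comp_le _ _ _
    rwa [List.map_map] at this

theorem hom_convolution (xs : List X) (y : X) :
    a.hom [h (a.convolution xs)] y = a.hom xs y := by
  simpa using H.hom_map_convolution [xs] y

theorem apply_convolution_singleton (ha : a.IsSeparated) (x : X) : h (a.convolution [x]) = x :=
  ha.eq_of_hom_eq (H.hom_convolution [x])

/-- `α` is compatible with the multiplication of the list monad. -/
theorem apply_convolution_map (ha : a.IsSeparated) (xss : List (List X)) :
    h (a.convolution (xss.map fun xs => h (a.convolution xs))) = h (a.convolution xss.flatten) :=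
  ha.eq_of_hom_eq fun y => by
    rw [H.hom_convolution, H.hom_map_convolution, H.hom_convolution]

theorem le_hom_weightedJoin {A : Type u} (j : A → V) (f : A → X) (x : A) :
    j x ≤ a.hom [f x] (h (a.weightedJoin j f)) := by
  refine H.le_hom_apply ?_
  rintro (_ | ⟨ws, _ | ⟨ws', wss⟩⟩)
  · simp
  · simpa [mul_comm, LVCategory.weightedJoin] using le_iSup (fun x => j x * a.hom ws (f x)) x
  · simp

/-- The element `h(⋁ₓ j(x) ⊗ a(-, f x))` is a weighted colimit in each variable of a list. -/
theorem hom_weightedJoin {A : Type u} (j : A → V) (f : A → X) (ps qs : List X) (y : X) :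
    a.hom (ps ++ h (a.weightedJoin j f) :: qs) y =
      ⨅ x, (j x ⇨ᵣ a.hom (ps ++ f x :: qs) y) := by
  refine le_antisymm (le_iInf_residuation_iff.2 fun x => ?_) ?_
  · refine (mul_le_mul_left (H.le_hom_weightedJoin j f x) _).trans ?_
    simpa using a.hom_mul_hom_le ps [f x] qs _ y
  · have := H.le_hom_map (y := y)
      (ψs := ps.map a.representable ++ a.weightedJoin j f :: qs.map a.representable)
      (t := ⨅ x, (j x ⇨ᵣ a.hom (ps ++ f x :: qs) y)) fun wss =>
        a.listRel_weightedJoin_mul_le j f ps qs wss fun x =>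
          (mul_le_mul_right (le_iInf_residuation_iff.1 le_rfl x) _).trans (a.comp_le _ _ _)
    rwa [List.map_append, List.map_cons, H.map_comp_representable,
      H.map_comp_representable] at this

end IsYonedaRetraction

/-- The monoidal `V`-category with `x ∗ y = α(x, y)` and unit `α()`, where
`α(xs) = h(convolution xs)`. The laws of an algebra for the list monad, applied to the lists of lists
`((x, y), (z))` and `((x), (y, z))`, give associativity. -/
def IsYonedaRetraction.monoidal {a : LVCategory V X} {h : (List X → V) → X}
    (H : IsYonedaRetraction a h) (ha : a.IsSeparated) : MonoidalVCategory V X where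
  hom x y := a.hom [x] y
  id_le := a.id_le
  comp_le x y z := by simpa using a.hom_mul_hom_le [] [x] [] y z
  tensor x y := h (a.convolution [x, y])
  unit := h (a.convolution [])
  tensor_assoc x y z := by
    have h₁ := H.apply_convolution_map ha [[x, y], [z]]
    have h₂ := H.apply_convolution_map ha [[x], [y, z]]
    simp only [List.map_cons, List.map_nil, H.apply_convolution_singleton ha] at h₁ h₂
    rw [h₁, h₂]
    rfl
  unit_tensor x := by
    have h₁ := H.apply_convolution_map ha [[], [x]]
    simpa [H.apply_convolution_singleton ha] using h₁
  tensor_unit x := by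
    have h₁ := H.apply_convolution_map ha [[x], []]
    simpa [H.apply_convolution_singleton ha] using h₁
  tensor_le x x' y y' := by
    rw [H.hom_convolution]
    have h₁ := a.comp_le [[x], [y]] [x', y'] (h (a.convolution [x', y']))
    refine le_trans ?_ h₁
    simpa using le_mul_of_one_le_right' (H.one_le_hom_convolution [x', y'])

namespace IsYonedaRetraction

variable {a : LVCategory V X} {h : (List X → V) → X}

theorem monoidal_tensorList (H : IsYonedaRetraction a h) (ha : a.IsSeparated) (xs : List X) :
    (H.monoidal ha).tensorList xs = h (a.convolution xs) := by
  induction xs with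
  | nil => rfl
  | cons x xs ih =>
    change h (a.convolution [x, (H.monoidal ha).tensorList xs]) = _
    have h₁ := H.apply_convolution_map ha [[x], xs]
    simpa [H.apply_convolution_singleton ha, ih] using h₁

/-- A `V`-functor `k` such that `k x` represents the list `ps ++ x :: qs` is cocontinuous. For
`ps = [x]`, `qs = []` and for `ps = []`, `qs = [x]` it is multiplication by `x`. -/
theorem isCocontinuous_of_hom_eq (H : IsYonedaRetraction a h) (ha : a.IsSeparated)
    (ps qs : List X) (k : X → X)
    (hk : IsVFunctor (H.monoidal ha).toVCategory (H.monoidal ha).toVCategory k)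
    (hkp : ∀ x y, a.hom [k x] y = a.hom (ps ++ x :: qs) y) :
    IsCocontinuous (H.monoidal ha).toVCategory (H.monoidal ha).toVCategory k := by
  refine ⟨hk, fun A C _ c f j g _ _ hg => ⟨fun z z' => (hg.1 z z').trans (hk _ _), fun z y => ?_⟩⟩
  -- By separatedness the given colimit is the one obtained from the retraction.
  have hgz : g z = h (a.weightedJoin (j · z) f) := ha.eq_of_hom_eq fun y =>
    (hg.2 z y).trans (H.hom_weightedJoin (j · z) f [] [] y).symm
  change a.hom [k (g z)] y = ⨅ x, (j x z ⇨ᵣ a.hom [k (f x)] y)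
  simp only [hkp, hgz, H.hom_weightedJoin]

theorem isVQuantale (H : IsYonedaRetraction a h) (ha : a.IsSeparated) :
    (H.monoidal ha).IsVQuantale where
  separated := ha
  cocomplete A C _ c f j _ hj := by
    have hcol : ∀ z y, a.hom [h (a.weightedJoin (j · z) f)] y =
        ⨅ x, (j x z ⇨ᵣ a.hom [f x] y) := fun z y => H.hom_weightedJoin (j · z) f [] [] y
    refine ⟨fun z => h (a.weightedJoin (j · z) f), fun z z' => ?_, hcol⟩
    change _ ≤ a.hom [_] _
    rw [hcol, le_iInf_residuation_iff]
    exact fun x => (hj.2 x z z').trans (H.le_hom_weightedJoin (j · z') f x)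
  cocontinuous_left x := by
    refine H.isCocontinuous_of_hom_eq ha [x] [] _ (fun y y' => ?_) fun y z => H.hom_convolution _ _
    exact (le_mul_of_one_le_left' (a.id_le x)).trans ((H.monoidal ha).tensor_le x x y y')
  cocontinuous_right x := by
    refine H.isCocontinuous_of_hom_eq ha [] [x] _ (fun y y' => ?_) fun y z => H.hom_convolution _ _
    exact (le_mul_of_one_le_right' (a.id_le x)).trans ((H.monoidal ha).tensor_le y y' x x)

end IsYonedaRetraction

theorem LVCategory.IsInjective.isVQuantale {a : LVCategory V X} (hinj : a.IsInjective)
    (ha : a.IsSeparated) : a.IsVQuantale := by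
  obtain ⟨h, H⟩ := hinj.exists_isYonedaRetraction
  refine ⟨H.monoidal ha, H.isVQuantale ha, fun xs y => ?_⟩
  rw [H.monoidal_tensorList ha]
  exact (H.hom_convolution xs y).symm

end Retraction

/-! ### `V`-quantales are injective -/

section Kan

variable {X : Type u}

variable (V X) in
/-- The discrete `V`-category: `k` on the diagonal and `⊥` elsewhere. -/
def discreteVCategory : VCategory V X where
  hom x y := ⨆ _ : x = y, 1
  id_le x := le_iSup_of_le rfl le_rfl
  comp_le x y z := by
    rw [iSup_mul_le_iff]
    rintro rfl
    rw [one_mul]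

theorem isVFunctor_discreteVCategory {A : Type u} (b : VCategory V X) (f : A → X) :
    IsVFunctor (discreteVCategory V A) b f := by
  intro x x'
  refine iSup_le ?_
  rintro rfl
  exact b.id_le _

theorem isVDistributor_discreteVCategory {A C : Type u} (j : A → C → V) :
    IsVDistributor (discreteVCategory V A) (discreteVCategory V C) j := by
  constructor
  · intro x x' z
    rw [discreteVCategory, iSup_mul_le_iff]
    rintro rfl
    rw [one_mul]
  · intro x z z'
    rw [discreteVCategory, mul_comm, iSup_mul_le_iff]
    rintro rfl
    rw [one_mul]

namespace MonoidalVCategory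

variable {M : MonoidalVCategory V X}

theorem tensorList_append (xs ys : List X) :
    M.tensorList (xs ++ ys) = M.tensor (M.tensorList xs) (M.tensorList ys) := by
  induction xs with
  | nil => exact (M.unit_tensor _).symm
  | cons x xs ih =>
    change M.tensor x (M.tensorList (xs ++ ys)) = M.tensor (M.tensor x (M.tensorList xs)) _
    rw [ih, M.tensor_assoc]

/-- Products of colimits are computed factorwise: to bound `p ∗ h(z₁) ∗ ⋯ ∗ h(zₙ)`, each `h(zᵢ)`
may be replaced by the elements of the diagram of which it is the colimit. -/
theorem IsVQuantale.le_hom_tensor_tensorList (hM : M.IsVQuantale) {Y Z : Type u}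
    {j : List Y → Z → V} {g : Y → X} {h : Z → X}
    (hh : IsVColimit (discreteVCategory V Z) M.toVCategory j
      (fun ys => M.tensorList (ys.map g)) h) {t : V} {x : X} (zs : List Z) (p : X)
    (ht : ∀ yss, listRel j yss zs * t ≤ M.hom (M.tensor p (M.tensorList (yss.flatten.map g))) x) :
    t ≤ M.hom (M.tensor p (M.tensorList (zs.map h))) x := by
  induction zs generalizing p t with
  | nil => simpa using ht []
  | cons z zs ih =>
    have hf := isVFunctor_discreteVCategory M.toVCategory fun ys : List Y =>
      M.tensorList (ys.map g)
    have hj := isVDistributor_discreteVCategory j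
    have h₁ := (hM.cocontinuous_left p).2 _ _ _ _ _ _ _ hf hj hh
    have h₂ := (hM.cocontinuous_right (M.tensorList (zs.map h))).2 _ _ _ _ _ _ _
      (isVFunctor_discreteVCategory _ _) hj h₁
    change t ≤ M.hom (M.tensor p (M.tensor (h z) (M.tensorList (zs.map h)))) x
    rw [← M.tensor_assoc]
    refine le_of_le_of_eq (le_iInf_residuation_iff.2 fun ys => ?_) (h₂.2 z x).symm
    refine ih _ fun yss => ?_
    have := ht (ys :: yss)
    rw [listRel_cons_cons, List.flatten_cons, List.map_append, tensorList_append,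
      ← M.tensor_assoc] at this
    rwa [mul_left_comm, ← mul_assoc]

end MonoidalVCategory

theorem LVCategory.IsVQuantale.isInjective {a : LVCategory V X} (ha : a.IsVQuantale) :
    a.IsInjective := by
  obtain ⟨M, hM, haM⟩ := ha
  intro Y Z b c i g hi hg
  obtain ⟨h, hh⟩ := hM.cocomplete (List Y) Z _ _ (fun ys : List Y => M.tensorList (ys.map g))
    (fun (ys : List Y) z => c.hom (ys.map i) z) (isVFunctor_discreteVCategory _ _)
    (isVDistributor_discreteVCategory _)
  have hle : ∀ (ys : List Y) z, c.hom (ys.map i) z ≤ M.hom (M.tensorList (ys.map g)) (h z) := by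
    intro ys z
    have := le_iInf_residuation_iff.1 (hh.2 z (h z)).le ys
    exact (le_mul_of_one_le_right' (M.id_le _)).trans this
  refine ⟨h, fun zs z => ?_, funext fun y => ?_⟩
  · -- The leading factor required for the induction over `zs` is the unit.
    rw [haM, ← M.unit_tensor (M.tensorList _)]
    refine hM.le_hom_tensor_tensorList hh zs _ fun yss => ?_
    rw [M.unit_tensor]
    refine le_trans ?_ (hle _ _)
    rw [List.map_flatten]
    refine le_of_eq_of_le ?_ (c.comp_le (yss.map (List.map i)) zs z)
    rw [listRel_map_left]
  · have hs : ∀ y, M.tensorList [g y] = g y := fun y => M.tensor_unit _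
    refine hM.separated _ _ ?_ ?_
    · refine le_of_le_of_eq (le_iInf_residuation_iff.2 fun ys => ?_) (hh.2 (i y) (g y)).symm
      -- Full faithfulness turns the weight `c(i(ys), i(y))` into `b(ys, y)`.
      rw [mul_one]
      change c.hom (ys.map i) (i y) ≤ M.hom (M.tensorList (ys.map g)) (g y)
      rw [← hi, ← haM]
      exact hg ys y
    · have := hle [y] (i y)
      rw [List.map_singleton, List.map_singleton, hs] at this
      refine le_trans ?_ this
      exact c.id_le _

end Kan

end QuantaleEnriched

theorem mainTheorem2 {V : Type u} [CommMonoid V] [CompleteLattice V] [IsQuantale V]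
    (hV : (1 : V) ≠ ⊥) {X : Type u} (a : QuantaleEnriched.LVCategory V X)
    (ha : a.IsSeparated) :
    a.IsInjective ↔ a.IsVQuantale :=
  ⟨fun h => h.isVQuantale ha, fun h => h.isInjective⟩
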